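/- Fix integers $r \ge 2$ and $k \not\equiv 0 \pmod r$. An $r$-graph is an $r$-uniform hypergraph. For a family $\mathcal F$ of finite $r$-graphs, an $r$-graph is $\mathcal F$-free if it contains no member of $\mathcal F$ as a (not necessarily induced) subgraph; $\delta_{r-1}(\mathcal H)$ is the minimum, over all $(r-1)$-sets $S$ of vertices of $\mathcal H$, of the number of edges containing $S$; $\mathrm{ex}_{r-1}(n,\mathcal F)$ is the maximum of $\delta_{r-1}(\mathcal H)$ over all $\mathcal F$-free $r$-graphs $\mathcal H$ on $n$ vertices; and $\gamma(\mathcal F)=\lim_{n\to\infty}\mathrm{ex}_{r-1}(n,\mathcal F)/n$ is the codegree Turán density. For $\ell>r$ the tight cycle $\mathcal C_\ell^r$ has vertex set $\{0,\dots,\ell-1\}$ and edges $\{i,i+1,\dots,i+r-1\}$ (modulo $\ell$) for $0\le i<\ell$. Let $\mathcal C_{\equiv k}^r$ be the family of all $\mathcal C_\ell^r$ with $\ell>r$ and $\ell\equiv k\pmod r$, and let $\mathcal C_{\equiv k}^r\text{-hom}$ be the family of all homomorphic images of its members, where $\mathcal H_2$ is a homomorphic image of $\mathcal H_1$ if some map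 $V(\mathcal H_1)\to V(\mathcal H_2)$ sends edges to edges and induces a surjection $E(\mathcal H_1)\to E(\mathcal H_2)$. Let $\mathrm{cyc}=(1\,2\,\dots\,r)\in S_r$. A subgroup of $S_r$ is called available if it contains no conjugate of $\mathrm{cyc}^k$ and is maximal, with respect to inclusion, among the subgroups of $S_r$ with this property. For $1\le i\le r-1$, let $S_i\times S_{r-i}\le S_r$ be the subgroup of all permutations that preserve $\{1,\dots,i\}$ (and hence $\{i+1,\dots,r\}$). Then the limit $\gamma(\mathcal C_{\equiv k}^r\text{-hom})$ exists, and: - if $r$ is even and $S_i\times S_{r-i}$ is available for every odd $i\in[1,r-1]$, then $\gamma(\mathcal C_{\equiv k}^r\text{-hom})=\tfrac12$; - otherwise, $\gamma(\mathcal C_{\equiv k}^r\text{-hom})\le\tfrac13$. -/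

import Mathlib

open Filter Topology

/-- An `r`-uniform hypergraph (`r`-graph) with vertex set `V`. -/
structure RGraph (r : ℕ) (V : Type*) where
  /-- the set of edges -/
  edges : Set (Finset V)
  sized : edges.Sized r

namespace RGraph

variable {r : ℕ} {V W : Type*}

/-- `f` is a homomorphism: it maps `r`-edges to `r`-edges. -/
def IsHom [DecidableEq W] (G : RGraph r V) (H : RGraph r W) (f : V → W) : Prop :=
  ∀ e ∈ G.edges, e.image f ∈ H.edges

/-- `H` is a homomorphic image of `G`: some homomorphism from `G` to `H` induces a surjection
from the edges of `G` onto the edges of `H`. -/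
def IsHomImage [DecidableEq W] (G : RGraph r V) (H : RGraph r W) : Prop :=
  ∃ f : V → W, G.IsHom H f ∧ ∀ e' ∈ H.edges, ∃ e ∈ G.edges, e.image f = e'

/-- `H` contains a (not necessarily induced) copy of `G` as a subgraph. -/
def Contains [DecidableEq W] (H : RGraph r W) (G : RGraph r V) : Prop :=
  ∃ f : V → W, Function.Injective f ∧ G.IsHom H f

/-- The degree `d(S)`: the number of edges containing the vertex set `S`. -/
noncomputable def degree (H : RGraph r V) (S : Finset V) : ℕ :=
  {e ∈ H.edges | S ⊆ e}.ncard

/-- The minimum codegree `δ_{r-1}(H)`: the minimum of `d(S)` over all `(r-1)`-sets `S` of vertices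
(with value `0` when there is no such set). -/
noncomputable def minCodegree (H : RGraph r V) : ℕ :=
  sInf {d | ∃ S : Finset V, S.card = r - 1 ∧ d = H.degree S}

/-- The tight `r`-uniform cycle of length `ℓ > r`: its vertices are `0, …, ℓ - 1` and its edges are
the sets `{i, i + 1, …, i + r - 1}`, with addition modulo `ℓ`. -/
def tightCycle (r ℓ : ℕ) (h : r < ℓ) : RGraph r (Fin ℓ) where
  edges := {e | ∃ i : Fin ℓ, e = (Finset.univ : Finset (Fin r)).image
    fun j => (⟨(i.val + j.val) % ℓ, Nat.mod_lt _ (by omega)⟩ : Fin ℓ)}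
  sized := by
    rintro e ⟨i, rfl⟩
    rw [Finset.card_image_of_injective, Finset.card_univ, Fintype.card_fin]
    intro a b hab
    have h1 : i.val + a.val ≡ i.val + b.val [MOD ℓ] := congrArg Fin.val hab
    have h2 := Nat.ModEq.add_left_cancel' _ h1
    exact Fin.ext (Nat.ModEq.eq_of_lt_of_lt h2 (by omega) (by omega))

end RGraph

/-- A family of finite `r`-graphs. Every finite `r`-graph is represented, up to isomorphism, on a
vertex set `{0, …, n - 1}`. -/
abbrev RFamily (r : ℕ) : Type := Set (Σ n : ℕ, RGraph r (Fin n))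

namespace RFamily

variable {r : ℕ}

/-- `F-hom`: the family of all homomorphic images of members of `F`. -/
def hom (F : RFamily r) : RFamily r :=
  {H | ∃ G ∈ F, G.2.IsHomImage H.2}

/-- `H` is `F`-free: it contains no member of `F` as a subgraph. -/
def Free {V : Type*} [DecidableEq V] (F : RFamily r) (H : RGraph r V) : Prop :=
  ∀ G ∈ F, ¬ H.Contains G.2

/-- The codegree Turán number `ex_{r-1}(n, F)`: the maximum of `δ_{r-1}(H)` over all `F`-free
`r`-graphs `H` on `n` vertices. -/
noncomputable def exCodegree (F : RFamily r) (n : ℕ) : ℕ :=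
  sSup {d | ∃ H : RGraph r (Fin n), F.Free H ∧ d = H.minCodegree}

/-- The codegree Turán density `γ(F) = lim ex_{r-1}(n, F) / n` exists and equals `γ`. -/
def HasCodegreeDensity (F : RFamily r) (γ : ℝ) : Prop :=
  Tendsto (fun n : ℕ => (F.exCodegree n : ℝ) / (n : ℝ)) atTop (𝓝 γ)

/-- The family of all `r`-uniform tight cycles whose length is congruent to `k` modulo `r`. -/
def tightCycles (r : ℕ) (k : ℤ) : RFamily r :=
  {G | ∃ (ℓ : ℕ) (h : r < ℓ), (ℓ : ℤ) ≡ k [ZMOD r] ∧ G = ⟨ℓ, RGraph.tightCycle r ℓ h⟩}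

end RFamily

/-- The subgroup `Γ` of the symmetric group contains no conjugate of `π`. -/
def ConjAvoiding {r : ℕ} (π : Equiv.Perm (Fin r)) (Γ : Subgroup (Equiv.Perm (Fin r))) : Prop :=
  ∀ σ : Equiv.Perm (Fin r), σ * π * σ⁻¹ ∉ Γ

open scoped Pointwise in
/-- The subgroup `S_i × S_{r-i}` of `S_r`: the permutations that map the set of the first `i` points
to itself (and hence also the set of the remaining `r - i` points). -/
def youngSubgroup (r i : ℕ) : Subgroup (Equiv.Perm (Fin r)) :=
  MulAction.stabilizer (Equiv.Perm (Fin r)) {j : Fin r | j.val < i}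

/-- `Γ` is an available color: it is a maximal subgroup of `S_r` among those that contain no
conjugate of `cyc ^ k`, where `cyc = finRotate r` is the cyclic shift. -/
def Available (r : ℕ) (k : ℤ) (Γ : Subgroup (Equiv.Perm (Fin r))) : Prop :=
  Maximal (ConjAvoiding (finRotate r ^ k)) Γ

/-! Work with ordered edges and replace one vertex at a time, keeping places: this is `Tied`. The
permutations of places that lead from `e` to a tied ordering form a group `stab e`. A tie is a tight
walk whose length is a multiple of `r`, and rotating an edge by `cyc^k` is a walk of length `k`
modulo `r`. So a conjugate of `cyc^k` in `stab e` would close up to a homomorphic tight cycle of a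
forbidden length (`conjAvoiding_stab`). In particular `stab e` is proper and misses some
transposition.

If one vertex completes `e` at place `i` and also at place `j`, then `swap i j ∈ stab e`. A missing
transposition therefore gives two disjoint neighbourhoods, whence the bound 1/2. Above 1/3, any two
of three neighbourhoods being disjoint is impossible, so exchangeability (`Sim`) has exactly two
classes of places. The key lemma `Dense.exists_class_sub_two` finds another edge where a class has
lost two places. Descent makes all class sizes odd, `r` even, and every odd size `i < r` occur. Then
`S_i × S_{r-i}` lies in the group of some edge, so it avoids the conjugates of `cyc^k`, and
`available_youngSubgroup` makes it maximal.

Conversely, if these subgroups avoid the conjugates, the `r`-sets meeting a fixed half of the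
vertices in an odd number of points form a free graph of codegree about `n/2`.

The limit exists because a random map from `m` points to a good graph pulls back to a free graph of
nearly the same relative codegree. -/

namespace RGraph

variable {r : ℕ} {V W : Type*} [DecidableEq V]

/-! ### Homomorphisms, ordered edges and ties -/

/-- The image of a homomorphism, with exactly the image edges, is itself a member of `F.hom` inside
`H`. -/
theorem _root_.RFamily.free_hom_iff {n : ℕ} {F : RFamily r} {H : RGraph r (Fin n)} :
    F.hom.Free H ↔ ∀ G ∈ F, ∀ f : Fin G.1 → Fin n, ¬ G.2.IsHom H f := by
  constructor
  · intro hF G hG f hf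
    refine hF ⟨n, ⟨{e' | ∃ e ∈ G.2.edges, e.image f = e'}, ?_⟩⟩ ⟨G, hG, f, ?_, ?_⟩ ⟨id, Function.injective_id, ?_⟩
    · rintro _ ⟨e, he, rfl⟩
      exact H.sized (hf e he)
    · exact fun e he => ⟨e, he, rfl⟩
    · exact fun e' he' => he'
    · rintro _ ⟨e, he, rfl⟩
      simpa using hf e he
  · rintro h G' ⟨G, hG, g, hg, -⟩ ⟨f, -, hf⟩
    refine h G hG (f ∘ g) fun e he => ?_
    rw [← Finset.image_image]
    exact hf _ (hg e he)

/-- The pull-back of an `r`-graph along a map of vertex sets. -/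
def comap (H : RGraph r V) (φ : W → V) : RGraph r W where
  edges := {e | e.card = r ∧ e.image φ ∈ H.edges}
  sized := fun _ he => he.1

theorem free_comap {m n : ℕ} {F : RFamily r} {H : RGraph r (Fin n)} (hH : F.hom.Free H)
    (φ : Fin m → Fin n) : F.hom.Free (H.comap φ) := by
  rw [RFamily.free_hom_iff] at hH ⊢
  refine fun G hG f hf => hH G hG (φ ∘ f) fun e he => ?_
  rw [← Finset.image_image]
  exact (hf e he).2

/-- `e` enumerates an edge of `H`. -/
def IsOrdEdge (H : RGraph r V) (e : Fin r → V) : Prop :=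
  Finset.univ.image e ∈ H.edges

/-- Two ordered edges that differ in at most one place. -/
def Replace (H : RGraph r V) (e e' : Fin r → V) : Prop :=
  H.IsOrdEdge e ∧ H.IsOrdEdge e' ∧ ∃ i, ∀ j, j ≠ i → e j = e' j

/-- Two ordered edges connected by replacements of single vertices in place. -/
def Tied (H : RGraph r V) : (Fin r → V) → (Fin r → V) → Prop :=
  Relation.ReflTransGen H.Replace

variable {H : RGraph r V} {e e' : Fin r → V}

theorem IsOrdEdge.injective (h : H.IsOrdEdge e) : Function.Injective e := by
  have : (Finset.univ.image e).card = (Finset.univ : Finset (Fin r)).card := by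
    rw [H.sized h]; simp
  have := Finset.card_image_iff.mp this
  simpa [Set.injOn_univ] using this

theorem isOrdEdge_comp (π : Equiv.Perm (Fin r)) : H.IsOrdEdge (e ∘ π) ↔ H.IsOrdEdge e := by
  unfold IsOrdEdge
  rw [← Finset.image_image, Finset.image_univ_of_surjective π.surjective]

theorem Replace.symm (h : H.Replace e e') : H.Replace e' e := by
  obtain ⟨h1, h2, i, hi⟩ := h
  exact ⟨h2, h1, i, fun j hj => (hi j hj).symm⟩

theorem Replace.comp (h : H.Replace e e') (π : Equiv.Perm (Fin r)) :
    H.Replace (e ∘ π) (e' ∘ π) := by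
  obtain ⟨h1, h2, i, hi⟩ := h
  refine ⟨(isOrdEdge_comp π).2 h1, (isOrdEdge_comp π).2 h2, π.symm i, fun j hj => hi _ ?_⟩
  rintro rfl
  simp at hj

theorem Tied.symm (h : H.Tied e e') : H.Tied e' e := by
  induction h with
  | refl => exact Relation.ReflTransGen.refl
  | tail _ h ih => exact Relation.ReflTransGen.head h.symm ih

theorem Tied.trans {e'' : Fin r → V} (h : H.Tied e e') (h' : H.Tied e' e'') : H.Tied e e'' :=
  Relation.ReflTransGen.trans h h'

theorem Tied.refl (e : Fin r → V) : H.Tied e e := Relation.ReflTransGen.refl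

theorem Tied.comp (h : H.Tied e e') (π : Equiv.Perm (Fin r)) : H.Tied (e ∘ π) (e' ∘ π) := by
  induction h with
  | refl => exact Relation.ReflTransGen.refl
  | tail _ h ih => exact Relation.ReflTransGen.tail ih (h.comp π)

theorem Tied.of_agree (h : H.IsOrdEdge e) (h' : H.IsOrdEdge e') (i : Fin r)
    (hi : ∀ j, j ≠ i → e j = e' j) : H.Tied e e' :=
  Relation.ReflTransGen.single ⟨h, h', i, hi⟩

/-- The group of the permutations of the places that lead from `e` to a tied ordered edge. -/
def stab (H : RGraph r V) (e : Fin r → V) : Subgroup (Equiv.Perm (Fin r)) where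
  carrier := {π | H.Tied (e ∘ π) e}
  one_mem' := Tied.refl e
  mul_mem' := by
    intro π ρ hπ hρ
    exact Tied.trans (Tied.comp hπ ρ) hρ
  inv_mem' := by
    intro π hπ
    have := (Tied.comp hπ π⁻¹).symm
    rwa [Function.comp_assoc, ← Equiv.Perm.coe_mul, mul_inv_cancel, Equiv.Perm.coe_one,
      Function.comp_id] at this

theorem mem_stab {π : Equiv.Perm (Fin r)} : π ∈ H.stab e ↔ H.Tied (e ∘ π) e := Iff.rfl

/-! ### Tight walks -/

/-- The `r` consecutive terms of the sequence `v` from the index `i` on. -/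
def window (r : ℕ) (v : ℕ → V) (i : ℕ) : Fin r → V := fun j => v (i + j)

/-- There is a tight walk with `m` steps from `e` to `e'`. -/
def Walk (H : RGraph r V) (m : ℕ) (e e' : Fin r → V) : Prop :=
  ∃ v : ℕ → V, window r v 0 = e ∧ window r v m = e' ∧ ∀ i ≤ m, H.IsOrdEdge (window r v i)

theorem Walk.trans {m m' : ℕ} {e'' : Fin r → V} (h : H.Walk m e e') (h' : H.Walk m' e' e'') :
    H.Walk (m + m') e e'' := by
  obtain ⟨v, hv0, hvm, hv⟩ := h
  obtain ⟨v', hv0', hvm', hv'⟩ := h'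
  have key : ∀ i ≤ m, window r (fun i => if i < m then v i else v' (i - m)) i = window r v i := by
    intro i hi
    funext j
    simp only [window]
    split_ifs with h
    · rfl
    · have h1 : i + j - m < r := by omega
      have h2 := congrFun (hvm.trans hv0'.symm) ⟨i + j - m, h1⟩
      simp only [window, zero_add] at h2
      rw [← h2]
      congr 1
      omega
  have key' : ∀ i, window r (fun i => if i < m then v i else v' (i - m)) (m + i)
      = window r v' i := by
    intro i
    funext j
    simp only [window]
    rw [if_neg (by omega)]
    congr 1
    omega
  refine ⟨fun i => if i < m then v i else v' (i - m), ?_, ?_, ?_⟩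
  · rw [key 0 (Nat.zero_le _), hv0]
  · rw [key', hvm']
  · intro i hi
    rcases le_total i m with h | h
    · rw [key i h]; exact hv i h
    · obtain ⟨t, rfl⟩ := Nat.exists_eq_add_of_le h
      rw [key']; exact hv' t (by omega)

theorem finRotate_pow_val (m : ℕ) (j : Fin r) : ((finRotate r ^ m) j).val = (m + j) % r := by
  induction m with
  | zero => simp [Nat.mod_eq_of_lt j.2]
  | succ m ih =>
    rcases r with _ | r
    · exact j.elim0
    rw [pow_succ', Equiv.Perm.mul_apply, finRotate_apply, Fin.val_add, ih, Fin.val_one',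
      ← Nat.add_mod]
    congr 1
    omega

theorem finRotate_zpow_eq_pow (hr : 0 < r) (k : ℤ) :
    finRotate r ^ k = finRotate r ^ (k % r).toNat := by
  have h1 : finRotate r ^ r = 1 := by
    ext j
    rw [finRotate_pow_val]
    simp [Nat.mod_eq_of_lt j.2]
  have h2 : ((k % r).toNat : ℤ) = k % r := Int.toNat_of_nonneg (Int.emod_nonneg _ (by omega))
  rw [← zpow_natCast, h2]
  conv_lhs => rw [← Int.mul_ediv_add_emod k r]
  rw [zpow_add, zpow_mul, zpow_natCast, h1, one_zpow, one_mul]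

theorem window_periodic {V : Type*} (hr : 0 < r) (e : Fin r → V) (i : ℕ) :
    window r (fun t => e ⟨t % r, Nat.mod_lt _ hr⟩) i = e ∘ ⇑(finRotate r ^ i) := by
  funext j
  simp only [window, Function.comp]
  congr 1
  exact Fin.ext (finRotate_pow_val i j).symm

theorem walk_finRotate_pow (hr : 0 < r) (he : H.IsOrdEdge e) (m : ℕ) :
    H.Walk m e (e ∘ ⇑(finRotate r ^ m)) := by
  refine ⟨fun t => e ⟨t % r, Nat.mod_lt _ hr⟩, ?_, window_periodic hr e m, fun i _ => ?_⟩
  · rw [window_periodic hr]; rfl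
  · rw [window_periodic hr]; exact (isOrdEdge_comp _).2 he

/-- Write `e` and then `e'`. As they differ only at place `i`, the window starting at `s` is a
rotation of `e` for `s ≤ i` and a rotation of `e'` afterwards. -/
theorem Replace.walk (hr : 0 < r) (h : H.Replace e e') : H.Walk r e e' := by
  obtain ⟨he, he', i, hi⟩ := h
  set v : ℕ → V := fun t => if t < r then e ⟨t % r, Nat.mod_lt _ hr⟩ else
    e' ⟨t % r, Nat.mod_lt _ hr⟩ with hv
  have key : ∀ s ≤ r, (s ≤ i → window r v s = e ∘ ⇑(finRotate r ^ s)) ∧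
      (i < s → window r v s = e' ∘ ⇑(finRotate r ^ s)) := by
    intro s hs
    constructor
    · intro hsi
      rw [← window_periodic hr]
      funext j
      simp only [window, hv]
      split_ifs with h
      · rfl
      · refine (hi _ fun h' => ?_).symm
        have h2 : (s + j) % r = i := congrArg Fin.val h'
        rw [Nat.mod_eq_sub_mod (by omega), Nat.mod_eq_of_lt (by omega)] at h2
        omega
    · intro hsi
      rw [← window_periodic hr]
      funext j
      simp only [window, hv]
      split_ifs with h
      · refine hi _ fun h' => ?_
        have h2 : (s + j) % r = i := congrArg Fin.val h'
        rw [Nat.mod_eq_of_lt (by omega)] at h2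
        omega
      · rfl
  refine ⟨v, ?_, ?_, ?_⟩
  · rw [(key 0 (by omega)).1 (by omega)]; rfl
  · rw [(key r le_rfl).2 i.2, ← window_periodic hr]
    funext j
    simp [window, Nat.mod_eq_of_lt j.2]
  · intro s hs
    rcases le_or_gt s i with h | h
    · rw [(key s hs).1 h]; exact (isOrdEdge_comp _).2 he
    · rw [(key s hs).2 h]; exact (isOrdEdge_comp _).2 he'

theorem Tied.walk (hr : 0 < r) (he : H.IsOrdEdge e) (h : H.Tied e e') :
    ∃ t, H.Walk (r * t) e e' := by
  induction h with
  | refl => exact ⟨0, walk_finRotate_pow hr he 0⟩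
  | tail _ h ih =>
    obtain ⟨t, ht⟩ := ih
    exact ⟨t + 1, ht.trans (h.walk hr)⟩

theorem Walk.exists_isHom {ℓ : ℕ} (h : r < ℓ) (hw : H.Walk ℓ e e) :
    ∃ f : Fin ℓ → V, (tightCycle r ℓ h).IsHom H f := by
  obtain ⟨v, hv0, hvℓ, hv⟩ := hw
  refine ⟨fun t => v t, ?_⟩
  rintro _ ⟨i, rfl⟩
  have : (Finset.univ.image (window r v i)) ∈ H.edges := hv i i.2.le
  convert this using 1
  rw [Finset.image_image]
  congr 1
  funext j
  simp only [Function.comp, window]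
  rcases lt_or_ge (i.val + j.val) ℓ with h1 | h1
  · rw [Nat.mod_eq_of_lt h1]
  · have h2 : i.val + j.val - ℓ < r := by omega
    have h3 := congrFun (hv0.trans hvℓ.symm) ⟨_, h2⟩
    simp only [window, zero_add] at h3
    rw [Nat.mod_eq_sub_mod h1, Nat.mod_eq_of_lt (by omega), h3]
    congr 1
    omega

theorem conjAvoiding_stab {n : ℕ} {k : ℤ} {H : RGraph r (Fin n)} {e : Fin r → Fin n}
    (hr : 0 < r) (hH : (RFamily.tightCycles r k).hom.Free H) (he : H.IsOrdEdge e) :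
    ConjAvoiding (finRotate r ^ k) (H.stab e) := by
  intro σ hσ
  rw [RFamily.free_hom_iff] at hH
  have h1 : H.Tied ((e ∘ σ) ∘ ⇑(finRotate r ^ (k % r).toNat)) (e ∘ σ) := by
    have := Tied.comp (mem_stab.1 hσ) σ
    rw [← finRotate_zpow_eq_pow hr]
    convert this using 1
    funext j
    simp
  have hσe : H.IsOrdEdge (e ∘ σ) := (isOrdEdge_comp σ).2 he
  obtain ⟨t, ht⟩ := h1.walk hr ((isOrdEdge_comp _).2 hσe)
  -- Two idle rounds of `r` steps make the closed walk longer than `r` without changing its length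
  -- modulo `r`.
  have h2 := (((walk_finRotate_pow hr hσe _).trans ht).trans
    ((Replace.walk hr ⟨hσe, hσe, ⟨0, hr⟩, fun _ _ => rfl⟩).trans
    (Replace.walk hr ⟨hσe, hσe, ⟨0, hr⟩, fun _ _ => rfl⟩)))
  have h3 : r < (k % r).toNat + r * t + (r + r) := by omega
  obtain ⟨f, hf⟩ := h2.exists_isHom h3
  refine hH ⟨_, tightCycle r _ h3⟩ ⟨_, h3, ?_, rfl⟩ f hf
  have h4 : ((k % r).toNat : ℤ) = k % r := Int.toNat_of_nonneg (Int.emod_nonneg _ (by omega))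
  push_cast
  rw [h4]
  unfold Int.ModEq
  rw [show k % (r:ℤ) + r * t + (r + r) = k % r + r * (t + 2) by ring, Int.add_mul_emod_self_left,
    Int.emod_emod]

end RGraph

/-! ### Groups containing transpositions, and three large sets -/

open Equiv in
-- A group generated by transpositions contains every permutation that preserves its orbits.
theorem Subgroup.mem_of_forall_swap_mem {α : Type*} [DecidableEq α] [Finite α]
    {G : Subgroup (Perm α)} {f : Perm α} (h : ∀ x, swap x (f x) ∈ G) : f ∈ G := by
  have hS : ∀ g ∈ {g : Perm α | g.IsSwap ∧ g ∈ G}, g.IsSwap := fun g hg => hg.1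
  have h1 : Subgroup.closure {g : Perm α | g.IsSwap ∧ g ∈ G} ≤ G :=
    (Subgroup.closure_le _).2 fun g hg => hg.2
  refine h1 ((mem_closure_isSwap hS).2 ⟨Set.toFinite _, fun x => ?_⟩)
  by_cases hx : f x = x
  · rw [hx]; exact MulAction.mem_orbit_self x
  · exact ⟨⟨swap x (f x), Subgroup.subset_closure ⟨⟨x, f x, Ne.symm hx, rfl⟩, h x⟩⟩,
      swap_apply_left x (f x)⟩

theorem Finset.exists_mem_inter_of_three {V : Type*} [Fintype V] [DecidableEq V]
    {A B C : Finset V} (hA : Fintype.card V < 3 * A.card) (hB : Fintype.card V < 3 * B.card)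
    (hC : Fintype.card V < 3 * C.card) :
    (∃ x, x ∈ A ∧ x ∈ B) ∨ (∃ x, x ∈ A ∧ x ∈ C) ∨ ∃ x, x ∈ B ∧ x ∈ C := by
  by_contra! h
  obtain ⟨h1, h2, h3⟩ := h
  have hAB : Disjoint A B := Finset.disjoint_left.2 h1
  have hABC : Disjoint (A ∪ B) C := Finset.disjoint_union_left.2
    ⟨Finset.disjoint_left.2 h2, Finset.disjoint_left.2 h3⟩
  have := Finset.card_le_univ (A ∪ B ∪ C)
  rw [Finset.card_union_of_disjoint hABC, Finset.card_union_of_disjoint hAB] at this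
  omega

/-! ### Exchangeable places and their classes -/

namespace RGraph

open Equiv Function

variable {r : ℕ} {V : Type*} [DecidableEq V] {H : RGraph r V} {e e' w : Fin r → V}

theorem Tied.isOrdEdge (h : H.Tied e e') (he : H.IsOrdEdge e) : H.IsOrdEdge e' := by
  cases h with
  | refl => exact he
  | tail _ h => exact h.2.1

/-- Transposing the places `i` and `j` leads to a tied ordered edge. -/
def Sim (H : RGraph r V) (e : Fin r → V) (i j : Fin r) : Prop := swap i j ∈ H.stab e

theorem Sim.refl (i : Fin r) : H.Sim e i i := by
  unfold Sim; rw [swap_self]; exact one_mem _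

theorem Sim.symm {i j : Fin r} (h : H.Sim e i j) : H.Sim e j i := by
  unfold Sim; rwa [swap_comm]

theorem sim_comm {i j : Fin r} : H.Sim e i j ↔ H.Sim e j i := ⟨Sim.symm, Sim.symm⟩

theorem Sim.trans {i j l : Fin r} (h : H.Sim e i j) (h' : H.Sim e j l) : H.Sim e i l :=
  SubmonoidClass.swap_mem_trans _ h h'

theorem Tied.stab_le (h : H.Tied e e') : H.stab e ≤ H.stab e' :=
  fun π hπ => ((h.comp π).symm.trans hπ).trans h

theorem Tied.sim_iff (h : H.Tied e e') {i j : Fin r} : H.Sim e i j ↔ H.Sim e' i j :=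
  ⟨fun h1 => h.stab_le h1, fun h1 => h.symm.stab_le h1⟩

theorem mem_stab_comp (σ π : Perm (Fin r)) :
    π ∈ H.stab (e ∘ σ) ↔ σ * π * σ⁻¹ ∈ H.stab e := by
  rw [mem_stab, mem_stab]
  constructor
  · intro h
    have := h.comp σ⁻¹
    convert this using 1
    all_goals
      funext j
      simp
  · intro h
    have := h.comp σ
    convert this using 1
    all_goals
      funext j
      simp

theorem sim_comp (σ : Perm (Fin r)) {i j : Fin r} :
    H.Sim (e ∘ σ) i j ↔ H.Sim e (σ i) (σ j) := by
  unfold Sim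
  rw [mem_stab_comp, swap_apply_apply]

theorem exists_not_sim (h : H.stab e ≠ ⊤) (i : Fin r) : ∃ j, ¬ H.Sim e i j := by
  by_contra! h1
  refine h (top_unique fun f _ => Subgroup.mem_of_forall_swap_mem fun x => ?_)
  exact (h1 x).symm.trans (h1 (f x))

/-- Some edge of `H` has a class of exactly `m` mutually exchangeable places, and more than one
class. -/
def HasClass (H : RGraph r V) (m : ℕ) : Prop :=
  ∃ e, H.IsOrdEdge e ∧ ∃ i j, ¬ H.Sim e i j ∧ {p | H.Sim e i p}.ncard = m

theorem HasClass.pos {m : ℕ} (h : H.HasClass m) : 0 < m := by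
  obtain ⟨e, -, i, j, -, rfl⟩ := h
  exact (Set.ncard_pos (Set.toFinite _)).2 ⟨i, Sim.refl i⟩

variable [Fintype V]

/-- The vertices that make up an ordered edge when put at the place `i` of `w`. -/
noncomputable def nbr (H : RGraph r V) (w : Fin r → V) (i : Fin r) : Finset V :=
  open Classical in Finset.univ.filter fun x => H.IsOrdEdge (update w i x)

theorem mem_nbr {i : Fin r} {x : V} : x ∈ H.nbr w i ↔ H.IsOrdEdge (update w i x) := by
  simp [nbr]

theorem degree_le_card_of_forall_mem {S N : Finset V} (hr : 0 < r) (hS : S.card = r - 1)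
    (hN : ∀ x, insert x S ∈ H.edges → x ∈ N) : H.degree S ≤ N.card := by
  have : {e ∈ H.edges | S ⊆ e} ⊆ (N.image fun x => insert x S : Finset (Finset V)) := by
    rintro e ⟨he, hSe⟩
    have h1 : (e \ S).card = 1 := by
      rw [Finset.card_sdiff_of_subset hSe, H.sized he, hS]
      omega
    obtain ⟨x, hx⟩ := Finset.card_eq_one.1 h1
    have h2 : insert x S = e := by
      rw [Finset.insert_eq, ← hx, Finset.sdiff_union_of_subset hSe]
    simp only [Finset.coe_image, Set.mem_image, Finset.mem_coe]
    exact ⟨x, hN x (h2 ▸ he), h2⟩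
  unfold degree
  calc _ ≤ _ := Set.ncard_le_ncard this (Set.toFinite _)
    _ ≤ _ := by
      rw [Set.ncard_coe_finset]
      exact Finset.card_image_le

theorem degree_le_card_nbr (hw : Injective w) (i : Fin r) :
    H.degree ((Finset.univ.erase i).image w) ≤ (H.nbr w i).card := by
  refine degree_le_card_of_forall_mem i.pos ?_ fun x hx => ?_
  · rw [Finset.card_image_of_injective _ hw, Finset.card_erase_of_mem (Finset.mem_univ i)]
    simp
  · rw [mem_nbr, IsOrdEdge, ← Finset.insert_erase (Finset.mem_univ i), Finset.image_insert,
      update_self]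
    convert hx using 2
    refine Finset.image_congr fun j hj => ?_
    rw [update_of_ne (by simpa using hj)]

theorem tied_update (he : H.IsOrdEdge e) {i : Fin r} {x : V} (hx : x ∈ H.nbr e i) :
    H.Tied e (update e i x) :=
  Tied.of_agree he (mem_nbr.1 hx) i fun j hj => by rw [update_of_ne hj]

theorem tied_update_update {i : Fin r} {x y : V} (hx : x ∈ H.nbr w i) (hy : y ∈ H.nbr w i) :
    H.Tied (update w i x) (update w i y) :=
  Tied.of_agree (mem_nbr.1 hx) (mem_nbr.1 hy) i fun j hj => by rw [update_of_ne hj, update_of_ne hj]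

theorem tied_update_swap {i j : Fin r} (hij : i ≠ j) {x : V} (hi : x ∈ H.nbr w i)
    (hj : x ∈ H.nbr w j) : H.Tied (update w i x) (update w j x ∘ swap i j) := by
  refine Tied.of_agree (mem_nbr.1 hi) ((isOrdEdge_comp _).2 (mem_nbr.1 hj)) j fun p hp => ?_
  by_cases hpi : p = i
  · subst hpi; simp
  · rw [update_of_ne hpi, comp_apply, swap_apply_of_ne_of_ne hpi hp, update_of_ne hp]

/-- Put `x` at place `i`, move the old `e i` to place `j`, then replace `x` at place `i` by the old
`e j`: each step is a single replacement. -/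
theorem sim_of_mem_nbr {i j : Fin r} (he : H.IsOrdEdge e) {x : V} (hi : x ∈ H.nbr e i)
    (hj : x ∈ H.nbr e j) : H.Sim e i j := by
  by_cases hij : i = j
  · subst hij; exact Sim.refl i
  · have h1 := (tied_update he hi).trans (tied_update_swap hij hi hj)
    exact ((tied_update he hj).comp _).trans h1.symm

/-- Every ordered `(r-1)`-set of vertices has more than a third of all vertices as neighbours. -/
def Dense (H : RGraph r V) : Prop :=
  ∀ w : Fin r → V, Injective w → ∀ i, Fintype.card V < 3 * (H.nbr w i).card

namespace Dense

theorem sim_or_sim (hD : H.Dense) (he : H.IsOrdEdge e) {i j : Fin r} (hij : ¬ H.Sim e i j) (l : Fin r) :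
    H.Sim e i l ∨ H.Sim e j l := by
  have hi := he.injective
  rcases Finset.exists_mem_inter_of_three (hD e hi i) (hD e hi j) (hD e hi l) with
    ⟨x, h1, h2⟩ | ⟨x, h1, h2⟩ | ⟨x, h1, h2⟩
  · exact absurd (sim_of_mem_nbr he h1 h2) hij
  · exact Or.inl (sim_of_mem_nbr he h1 h2)
  · exact Or.inr (sim_of_mem_nbr he h1 h2)

theorem sim_iff_not (hD : H.Dense) (he : H.IsOrdEdge e) {i j : Fin r} (hij : ¬ H.Sim e i j) (l : Fin r) :
    H.Sim e j l ↔ ¬ H.Sim e i l := by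
  constructor
  · exact fun h1 h2 => hij (h2.trans h1.symm)
  · exact fun h => (hD.sim_or_sim he hij l).resolve_left h

/-- The neighbourhoods of `e` at `i` and `j` are disjoint, so that of `e'` at `j` meets one of them.
Which one decides whether the tie is straight or transposed. -/
theorem tied_or_tied (hD : H.Dense) (he : H.IsOrdEdge e) (he' : H.IsOrdEdge e') {i j : Fin r}
    (hij : ¬ H.Sim e i j) (hag : ∀ p, p ≠ i → p ≠ j → e p = e' p) :
    H.Tied e e' ∨ H.Tied e (e' ∘ swap i j) := by
  have hne : i ≠ j := by rintro rfl; exact hij (Sim.refl i)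
  rcases Finset.exists_mem_inter_of_three (hD e he.injective i) (hD e he.injective j)
    (hD e' he'.injective j) with ⟨x, h1, h2⟩ | ⟨x, h1, h2⟩ | ⟨x, h1, h2⟩
  · exact absurd (sim_of_mem_nbr he h1 h2) hij
  · right
    refine (tied_update he h1).trans (Tied.trans ?_ ((tied_update he' h2).symm.comp _))
    refine Tied.of_agree (mem_nbr.1 h1) ((isOrdEdge_comp _).2 (mem_nbr.1 h2)) j fun p hp => ?_
    by_cases hpi : p = i
    · subst hpi; simp
    · rw [update_of_ne hpi, comp_apply, swap_apply_of_ne_of_ne hpi hp, update_of_ne hp, hag p hpi hp]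
  · left
    refine (tied_update he h1).trans (Tied.trans ?_ (tied_update he' h2).symm)
    refine Tied.of_agree (mem_nbr.1 h1) (mem_nbr.1 h2) i fun p hp => ?_
    by_cases hpi : p = j
    · subst hpi; simp
    · rw [update_of_ne hpi, update_of_ne hpi, hag p hp hpi]

theorem sim_iff_of_agree (hD : H.Dense) (he : H.IsOrdEdge e) (he' : H.IsOrdEdge e') {i j : Fin r}
    (hag : ∀ p, p ≠ i → p ≠ j → e p = e' p) : H.Sim e i j ↔ H.Sim e' i j := by
  have key : ∀ {e e' : Fin r → V}, H.IsOrdEdge e → H.IsOrdEdge e' →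
      (∀ p, p ≠ i → p ≠ j → e p = e' p) → ¬ H.Sim e i j → ¬ H.Sim e' i j := by
    intro e e' he he' hag hij
    rcases hD.tied_or_tied he he' hij hag with h | h
    · rwa [← h.sim_iff]
    · rw [h.sim_iff, sim_comp, swap_apply_left, swap_apply_right, sim_comm] at hij
      exact hij
  exact not_iff_not.1 ⟨key he he' hag, key he' he fun p h1 h2 => (hag p h1 h2).symm⟩

/-- Let `A` be the class of `a` in `e`. Put a new vertex `y` at place `a` to get `w`, and complete
`w` at each place `p` to an edge `E p`. The edges `E p` with `p` outside `A` are tied to transposed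
copies of `e`; those with `p ∈ A \ {a}` are tied to transposed copies of one another. In `E α` the
place `α` joins `a` and the complement of `A`, and the other class is `A \ {a, α}`. -/
theorem exists_class_sub_two (hD : H.Dense) (hS : ∀ e, H.IsOrdEdge e → H.stab e ≠ ⊤)
    (hV : 3 ≤ Fintype.card V) (he : H.IsOrdEdge e) {a b α : Fin r} (hab : ¬ H.Sim e a b)
    (haα : a ≠ α) (hα : H.Sim e a α) :
    ∃ e', H.IsOrdEdge e' ∧ ∃ i j, ¬ H.Sim e' i j ∧
      ∀ p, H.Sim e' j p ↔ H.Sim e a p ∧ p ≠ a ∧ p ≠ α := by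
  have hne : a ≠ b := by rintro rfl; exact hab (Sim.refl a)
  -- Since `y` completes `e` at `b`, the edge `E b` below turns out to be `e` with `a` and `b`
  -- exchanged, up to a tie.
  obtain ⟨y, hy, hyb⟩ : ∃ y ∈ H.nbr e b, y ≠ e b := by
    have := hD e he.injective b
    exact Finset.exists_mem_ne (by omega) _
  have hye : ∀ p, y ≠ e p := by
    intro p hp
    by_cases hpb : p = b
    · subst hpb; exact hyb hp
    · have := (mem_nbr.1 hy).injective
      refine hpb (this ?_)
      rw [update_self, update_of_ne hpb, hp]
  set w := update e a y with hw
  have hwi : Injective w := by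
    intro p q hpq
    by_cases hp : p = a <;> by_cases hq : q = a
    · rw [hp, hq]
    · subst hp; rw [hw, update_self, update_of_ne hq] at hpq; exact absurd hpq (hye q)
    · subst hq; rw [hw, update_self, update_of_ne hp] at hpq; exact absurd hpq.symm (hye p)
    · rw [hw, update_of_ne hp, update_of_ne hq] at hpq; exact he.injective hpq
  have hz : ∀ p, ∃ x, x ∈ H.nbr w p := fun p => by
    have := hD w hwi p
    exact Finset.card_pos.1 (by omega)
  choose z hz using hz
  set E : Fin r → Fin r → V := fun p => update w p (z p) with hE
  have hEe : ∀ p, H.IsOrdEdge (E p) := fun p => mem_nbr.1 (hz p)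
  have hEof : ∀ p q, q ≠ p → E p q = w q := fun p q h => update_of_ne h _ _
  have hwof : ∀ q, q ≠ a → w q = e q := fun q h => update_of_ne h _ _
  have hwa : w a = y := update_self _ _ _
  have fsymm : ∀ p q, H.Sim (E p) p q ↔ H.Sim (E q) p q := fun p q =>
    hD.sim_iff_of_agree (hEe p) (hEe q) fun s hp hq => by rw [hEof p s hp, hEof q s hq]
  have hEa : H.Tied (E a) e := Tied.of_agree (hEe a) he a fun p hp => by
    rw [hEof a p hp, hwof p hp]
  have hEb : H.Tied (E b) (e ∘ swap a b) := by
    refine Tied.trans (Tied.of_agree (hEe b) ((isOrdEdge_comp _).2 (mem_nbr.1 hy)) b fun p hp => ?_)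
      ((tied_update he hy).symm.comp _)
    by_cases hpa : p = a
    · subst hpa; rw [hEof b p hp, hwa]; simp
    · rw [hEof b p hp, hwof p hpa, comp_apply, swap_apply_of_ne_of_ne hpa hp, update_of_ne hp]
  -- A straight tie from `e` to `E β` would carry the relation of `β` and `b` over to `E b`, where
  -- it says that `a` and `β` are exchangeable in `e`.
  have hEβ : ∀ β, ¬ H.Sim e a β → H.Tied (E β) (e ∘ swap a β) := by
    intro β hβ
    by_cases hβb : β = b
    · rw [hβb]; exact hEb
    have hβa : β ≠ a := by rintro rfl; exact hβ (Sim.refl _)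
    rcases hD.tied_or_tied he (hEe β) hβ fun p hpa hpβ => by rw [hEof β p hpβ, hwof p hpa] with h | h
    · have h1 : H.Sim e β b := ((hD.sim_iff_not he hab β).2 hβ).symm
      rw [h.sim_iff, fsymm, hEb.sim_iff, sim_comp, swap_apply_of_ne_of_ne hβa hβb,
        swap_apply_right] at h1
      exact absurd h1.symm hβ
    · have := (h.comp (swap a β)).symm
      rwa [comp_assoc, ← Perm.coe_mul, swap_mul_self, Perm.coe_one, comp_id] at this
  have hA : ∀ α, H.Sim e a α → a ≠ α → ∀ β, (¬ H.Sim e a β ∨ β = a) → H.Sim (E α) α β := by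
    rintro α hα haα β (hβ | rfl)
    · rw [fsymm, (hEβ β hβ).sim_iff, sim_comp, swap_apply_right,
        swap_apply_of_ne_of_ne haα.symm (by rintro rfl; exact hβ hα)]
      exact hα.symm
    · rw [fsymm, hEa.sim_iff]
      exact hα.symm
  -- A common vertex would tie `E α` to `e ∘ swap α a`. But `a` and `b` are exchangeable in `E α`,
  -- whereas `α` and `b` are not in `e`.
  have hdisj : ∀ α, H.Sim e a α → a ≠ α → ∀ x, x ∈ H.nbr w α → x ∈ H.nbr w a → False := by
    intro α hα haα x h1 h2
    have h3 : H.Tied (E α) (e ∘ swap α a) := (tied_update_update (hz α) h1).trans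
      ((tied_update_swap haα.symm h1 h2).trans (((tied_update_update h2 (hz a)).trans hEa).comp _))
    have h4 : H.Sim (E α) a b := (hA α hα haα a (Or.inr rfl)).symm.trans
      (hA α hα haα b (Or.inl hab))
    rw [h3.sim_iff, sim_comp, swap_apply_right, swap_apply_of_ne_of_ne
      (by rintro rfl; exact hab hα) hne.symm] at h4
    exact hab (hα.trans h4)
  -- Two of the neighbourhoods of `w` at `α`, `α'`, `a` meet, and the one at `a` is disjoint from
  -- the others.
  have hAA : ∀ α α', H.Sim e a α → a ≠ α → H.Sim e a α' → a ≠ α' → α ≠ α' →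
      H.Tied (E α) (E α' ∘ swap α α') := by
    intro α α' hα haα hα' haα' hαα'
    rcases Finset.exists_mem_inter_of_three (hD w hwi α) (hD w hwi α') (hD w hwi a) with
      ⟨x, h1, h2⟩ | ⟨x, h1, h2⟩ | ⟨x, h1, h2⟩
    · exact (tied_update_update (hz α) h1).trans
        ((tied_update_swap hαα' h1 h2).trans ((tied_update_update h2 (hz α')).comp _))
    · exact (hdisj α hα haα x h1 h2).elim
    · exact (hdisj α' hα' haα' x h1 h2).elim
  obtain ⟨α₁, hα₁⟩ := exists_not_sim (hS _ (hEe α)) α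
  have hA₁ : H.Sim e a α₁ := by
    by_contra h
    exact hα₁ (hA α hα haα α₁ (Or.inl h))
  have haα₁ : a ≠ α₁ := by
    rintro rfl
    exact hα₁ (hA α hα haα a (Or.inr rfl))
  have hαα₁ : α ≠ α₁ := by
    rintro rfl
    exact hα₁ (Sim.refl _)
  refine ⟨E α, hEe α, α, α₁, hα₁, fun p => ?_⟩
  rw [hD.sim_iff_not (hEe α) hα₁]
  constructor
  · intro h
    refine ⟨?_, ?_, ?_⟩
    · by_contra h1
      exact h (hA α hα haα p (Or.inl h1))
    · exact fun h1 => h (hA α hα haα p (Or.inr h1))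
    · rintro rfl
      exact h (Sim.refl _)
  · rintro ⟨hp, hpa, hpα⟩ h
    by_cases hp₁ : p = α₁
    · exact hα₁ (hp₁ ▸ h)
    -- Going round `E α`, `E α₁`, `E p` and back to `E α` turns the pair `α, p` into the pair `α,
    -- α₁`.
    rw [(hAA α α₁ hα haα hA₁ haα₁ hαα₁).sim_iff, sim_comp, swap_apply_left,
      swap_apply_of_ne_of_ne hpα hp₁,
      (hAA α₁ p hA₁ haα₁ hp hpa.symm (Ne.symm hp₁)).sim_iff, sim_comp, swap_apply_left,
      swap_apply_right, (hAA p α hp hpa.symm hα haα hpα).sim_iff, sim_comp, swap_apply_left,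
      swap_apply_of_ne_of_ne (Ne.symm hp₁) hαα₁.symm] at h
    exact hα₁ h

theorem hasClass_compl (hD : H.Dense) {m : ℕ} (h : H.HasClass m) : ∃ m', H.HasClass m' ∧ m + m' = r := by
  obtain ⟨e, he, i, j, hij, rfl⟩ := h
  refine ⟨_, ⟨e, he, j, i, fun h => hij h.symm, rfl⟩, ?_⟩
  have h1 : {p | H.Sim e j p} = {p | H.Sim e i p}ᶜ := by
    ext p
    exact hD.sim_iff_not he hij p
  rw [h1, Set.ncard_add_ncard_compl]
  simp

theorem hasClass_sub_two (hD : H.Dense) (hS : ∀ e, H.IsOrdEdge e → H.stab e ≠ ⊤) (hV : 3 ≤ Fintype.card V)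
    {m : ℕ} (h : H.HasClass (m + 2)) : H.HasClass m := by
  obtain ⟨e, he, a, b, hab, hm⟩ := h
  obtain ⟨α, hα, haα⟩ : ∃ α ∈ {p | H.Sim e a p}, α ≠ a :=
    Set.exists_ne_of_one_lt_ncard (by omega) a
  obtain ⟨e', he', i, j, hij, h⟩ := hD.exists_class_sub_two hS hV he hab haα.symm hα
  refine ⟨e', he', j, i, fun h => hij h.symm, ?_⟩
  have h1 : {p | H.Sim e' j p} = ({p | H.Sim e a p} \ {a}) \ {α} := by
    ext p
    simp [h, and_assoc]
  have h2 : α ∈ {p | H.Sim e a p} \ {a} := ⟨hα, haα⟩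
  have h3 : a ∈ {p | H.Sim e a p} := Sim.refl a
  rw [h1, Set.ncard_sdiff_singleton_of_mem h2, Set.ncard_sdiff_singleton_of_mem h3, hm]
  rfl

/-- An even class size would descend to 0, but classes are nonempty. Odd sizes descend to 1, whose
complement has size `r - 1`; descending from there reaches every odd size. -/
theorem hasClass_of_odd (hD : H.Dense) (hS : ∀ e, H.IsOrdEdge e → H.stab e ≠ ⊤) (hV : 3 ≤ Fintype.card V)
    (he : H.IsOrdEdge e) (hr : 0 < r) :
    Even r ∧ ∀ m, Odd m → m < r → H.HasClass m := by
  have hsub : ∀ t m, H.HasClass (m + 2 * t) → H.HasClass m := by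
    intro t
    induction t with
    | zero => exact fun m h => h
    | succ t ih => exact fun m h => ih m (hD.hasClass_sub_two hS hV h)
  have hodd : ∀ m, H.HasClass m → Odd m := by
    intro m h
    by_contra hm
    obtain ⟨t, rfl⟩ := (Nat.not_odd_iff_even.1 hm).two_dvd
    have := (hsub t 0 (by rwa [zero_add])).pos
    omega
  obtain ⟨j, hj⟩ := exists_not_sim (hS e he) ⟨0, hr⟩
  have h1 : H.HasClass _ := ⟨e, he, _, j, hj, rfl⟩
  obtain ⟨m', h2, h3⟩ := hD.hasClass_compl h1
  have hone : H.HasClass 1 := by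
    obtain ⟨t, ht⟩ := hodd _ h1
    exact hsub t 1 (by rwa [add_comm 1, ← ht])
  refine ⟨h3 ▸ (hodd _ h1).add_odd (hodd _ h2), fun m hm hmr => ?_⟩
  obtain ⟨q, hq, hqr⟩ := hD.hasClass_compl hone
  obtain ⟨s, hs⟩ := hodd _ hq
  obtain ⟨t, ht⟩ := hm
  exact hsub (s - t) m (by convert hq using 1; omega)

end Dense

end RGraph

/-! ### Maximality of the subgroups `S_j × S_{r-j}` -/

section YoungSubgroup

open Equiv

variable {r : ℕ}

theorem mem_youngSubgroup {j : ℕ} {π : Perm (Fin r)} :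
    π ∈ youngSubgroup r j ↔ ∀ x, (π x).val < j ↔ x.val < j := by
  unfold youngSubgroup
  rw [MulAction.mem_stabilizer_set]
  rfl

theorem swap_mem_youngSubgroup {j : ℕ} {p q : Fin r} (h : p.val < j ↔ q.val < j) :
    swap p q ∈ youngSubgroup r j := by
  rw [mem_youngSubgroup]
  intro x
  rw [swap_apply_def]
  split_ifs with h1 h2
  · rw [h1, h]
  · rw [h2, h]
  · rfl

theorem Equiv.Perm.exists_apply_iff {α : Type*} [Finite α] {p q : α → Prop}
    (h : {x | p x}.ncard = {x | q x}.ncard) : ∃ σ : Perm α, ∀ x, q (σ x) ↔ p x := by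
  classical
  have := Fintype.ofFinite α
  have h1 : Fintype.card {x // p x} = Fintype.card {x // q x} := by
    rw [← Nat.card_eq_fintype_card, ← Nat.card_eq_fintype_card]
    exact h
  refine ⟨(Fintype.equivOfCardEq h1).extendSubtype, fun x => ⟨fun hx => ?_, fun hx => ?_⟩⟩
  · by_contra hp
    exact Equiv.extendSubtype_not_mem _ x hp hx
  · exact Equiv.extendSubtype_mem _ x hx

theorem Equiv.Perm.two_mul_ncard_of_apply_iff_not {α : Type*} [Finite α] {p : α → Prop}
    {f : Perm α} (h : ∀ x, p (f x) ↔ ¬ p x) : 2 * {x | p x}.ncard = Nat.card α := by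
  have h1 : f '' {x | p x} = {x | p x}ᶜ := by
    ext y
    obtain ⟨x, rfl⟩ := f.surjective y
    simp [h]
  have h2 := Set.ncard_image_of_injective {x | p x} f.injective
  have h3 := Set.ncard_add_ncard_compl {x | p x}
  rw [← h1, h2] at h3
  omega

theorem even_finRotate (hr : Even r) (x : Fin r) :
    Even (finRotate r x).val ↔ ¬ Even x.val := by
  have h := RGraph.finRotate_pow_val 1 x
  rw [pow_one] at h
  have h2 := Nat.div_add_mod (1 + x.val) r
  rw [← h] at h2
  have h3 : Even (r * ((1 + x.val) / r)) := hr.mul_right _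
  have h4 : Even (finRotate r x).val ↔ Even (1 + x.val) := by
    rw [← h2, Nat.even_add]
    tauto
  rw [h4, add_comm, Nat.even_add_one]

/-- Take `g` in a larger group `Γ`. If `g` does not permute the two blocks, conjugating a
transposition by it joins the blocks and `Γ` contains all transpositions. Otherwise `g` exchanges
the blocks, so `r = 2j`; so does a conjugate of `cyc`, which exchanges even and odd positions as `r`
is even. This conjugate then lies in `Γ`, and with it its `k`-th power. -/
theorem available_youngSubgroup (hr : Even r) {k : ℤ} {j : ℕ} (hj : 0 < j) (hjr : j < r)
    (h : ConjAvoiding (finRotate r ^ k) (youngSubgroup r j)) :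
    Available r k (youngSubgroup r j) := by
  refine ⟨h, fun Γ hΓ hle g hg => ?_⟩
  by_contra hgY
  by_cases hcase : ∃ p q : Fin r, (p.val < j ↔ q.val < j) ∧ ¬ ((g p).val < j ↔ (g q).val < j)
  · obtain ⟨p, q, hpq, hgpq⟩ := hcase
    have h1 : swap (g p) (g q) ∈ Γ := by
      rw [swap_apply_apply]
      exact mul_mem (mul_mem hg (hle (swap_mem_youngSubgroup hpq))) (inv_mem hg)
    have h2 : ∀ x, swap (g p) x ∈ Γ := by
      intro x
      by_cases hx : (g p).val < j ↔ x.val < j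
      · exact hle (swap_mem_youngSubgroup hx)
      · exact SubmonoidClass.swap_mem_trans Γ h1 (hle (swap_mem_youngSubgroup (by tauto)))
    refine hΓ 1 (Subgroup.mem_of_forall_swap_mem fun x => ?_)
    refine SubmonoidClass.swap_mem_trans Γ ?_ (h2 _)
    rw [swap_comm]
    exact h2 x
  · push Not at hcase
    have hflip : ∀ y : Fin r, (g y).val < j ↔ ¬ y.val < j := by
      rw [mem_youngSubgroup, not_forall] at hgY
      obtain ⟨x, hx⟩ := hgY
      obtain ⟨z, hz⟩ := g.surjective ⟨0, by omega⟩
      obtain ⟨z', hz'⟩ := g.surjective ⟨j, hjr⟩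
      have h1 : (g z).val < j := by rw [hz]; exact hj
      have h2 : ¬ (g z').val < j := by rw [hz']; exact lt_irrefl j
      intro y
      by_cases hxy : x.val < j ↔ y.val < j
      · have := hcase x y hxy
        tauto
      · by_contra hy
        have key : ∀ t, (g t).val < j ↔ (g x).val < j := by
          intro t
          by_cases hxt : x.val < j ↔ t.val < j
          · exact (hcase x t hxt).symm
          · have := hcase y t (by tauto)
            tauto
        exact h2 ((key z').2 ((key z).1 h1))
    have h1 := Equiv.Perm.two_mul_ncard_of_apply_iff_not (p := fun x : Fin r => x.val < j) hflip
    have h2 := Equiv.Perm.two_mul_ncard_of_apply_iff_not (p := fun x : Fin r => Even x.val)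
      (even_finRotate hr)
    -- Both the even positions and the first block have `r/2` elements, so some `σ` takes one to the
    -- other.
    obtain ⟨σ, hσ⟩ := Equiv.Perm.exists_apply_iff
      (p := fun x : Fin r => Even x.val) (q := fun x : Fin r => x.val < j) (by omega)
    have h3 : σ * finRotate r * σ⁻¹ * g ∈ Γ := by
      refine hle (mem_youngSubgroup.2 fun x => ?_)
      have h4 := hσ (σ⁻¹ (g x))
      have h5 := hσ (finRotate r (σ⁻¹ (g x)))
      rw [even_finRotate hr, ← h4, show σ (σ⁻¹ (g x)) = g x from σ.apply_symm_apply _, hflip, not_not] at h5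
      exact h5
    have h4 := mul_mem h3 (inv_mem hg)
    rw [mul_inv_cancel_right] at h4
    refine hΓ σ ?_
    rw [← conj_zpow]
    exact zpow_mem h4 k

end YoungSubgroup

/-! ### Upper bounds for the codegree -/

namespace RGraph

open Equiv Function

variable {r : ℕ} {V : Type*} [DecidableEq V] [Fintype V] {H : RGraph r V}

/-- Reorder the edge so that the class occupies the first `m` places. A permutation preserving both
classes moves every place to an exchangeable one. -/
theorem HasClass.exists_youngSubgroup_le (hD : H.Dense) {m : ℕ} (h : H.HasClass m) :
    ∃ e, H.IsOrdEdge e ∧ youngSubgroup r m ≤ H.stab e := by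
  obtain ⟨e, he, i, j, hij, hm⟩ := h
  have hmr : m ≤ r := by
    rw [← hm]
    simpa using Set.ncard_le_card {p | H.Sim e i p}
  have h1 : {x : Fin r | x.val < m}.ncard = m := by
    rw [Set.ncard_eq_toFinset_card', Set.toFinset_ofPred, Fin.card_filter_val_lt, min_eq_right hmr]
  obtain ⟨σ, hσ⟩ := Equiv.Perm.exists_apply_iff (h1.trans hm.symm)
  refine ⟨e ∘ σ, (isOrdEdge_comp σ).2 he, fun π hπ => Subgroup.mem_of_forall_swap_mem fun x => ?_⟩
  change H.Sim _ _ _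
  rw [sim_comp]
  have h2 := mem_youngSubgroup.1 hπ x
  rw [← hσ, ← hσ] at h2
  by_cases hx : H.Sim e i (σ x)
  · exact hx.symm.trans (h2.2 hx)
  · have hx' : ¬ H.Sim e i (σ (π x)) := fun h => hx (h2.1 h)
    rw [← hD.sim_iff_not he hij] at hx hx'
    exact hx.symm.trans hx'

theorem stab_ne_top {n : ℕ} {k : ℤ} {H : RGraph r (Fin n)} {e : Fin r → Fin n}
    (hr : 0 < r) (hH : (RFamily.tightCycles r k).hom.Free H) (he : H.IsOrdEdge e) :
    H.stab e ≠ ⊤ := by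
  intro h
  refine conjAvoiding_stab hr hH he 1 ?_
  rw [h]
  exact Subgroup.mem_top _

theorem minCodegree_le_card_nbr {w : Fin r → V} (hw : Injective w) (i : Fin r) :
    H.minCodegree ≤ (H.nbr w i).card := by
  refine le_trans (Nat.sInf_le ⟨_, ?_, rfl⟩) (degree_le_card_nbr hw i)
  rw [Finset.card_image_of_injective _ hw, Finset.card_erase_of_mem (Finset.mem_univ i)]
  simp

theorem exists_isOrdEdge (hr : 0 < r) (hV : r ≤ Fintype.card V) (h : 0 < H.minCodegree) :
    ∃ e, H.IsOrdEdge e := by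
  obtain ⟨w⟩ := Function.Embedding.nonempty_of_card_le (α := Fin r) (β := V) (by simpa using hV)
  obtain ⟨x, hx⟩ := Finset.card_pos.1 (h.trans_le (minCodegree_le_card_nbr w.injective ⟨0, hr⟩))
  exact ⟨_, mem_nbr.1 hx⟩

theorem two_mul_minCodegree_le {n : ℕ} {k : ℤ} {H : RGraph r (Fin n)} (hr : 0 < r) (hn : r ≤ n)
    (hH : (RFamily.tightCycles r k).hom.Free H) : 2 * H.minCodegree ≤ n := by
  by_contra! h
  obtain ⟨e, he⟩ := exists_isOrdEdge (H := H) hr (by simpa using hn) (by omega)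
  obtain ⟨j, hj⟩ := exists_not_sim (stab_ne_top hr hH he) ⟨0, hr⟩
  have h1 := minCodegree_le_card_nbr (H := H) he.injective ⟨0, hr⟩
  have h2 := minCodegree_le_card_nbr (H := H) he.injective j
  have h3 : Disjoint (H.nbr e ⟨0, hr⟩) (H.nbr e j) :=
    Finset.disjoint_left.2 fun x hx hx' => hj (sim_of_mem_nbr he hx hx')
  have h4 := Finset.card_le_univ (H.nbr e ⟨0, hr⟩ ∪ H.nbr e j)
  rw [Finset.card_union_of_disjoint h3, Fintype.card_fin] at h4
  omega

theorem available_of_lt_three_mul_minCodegree {n : ℕ} {k : ℤ} {H : RGraph r (Fin n)} (hr : 2 ≤ r)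
    (hn : r ≤ n) (hn' : 3 ≤ n) (hH : (RFamily.tightCycles r k).hom.Free H)
    (h : n < 3 * H.minCodegree) :
    Even r ∧ ∀ i : ℕ, Odd i → 1 ≤ i → i ≤ r - 1 → Available r k (youngSubgroup r i) := by
  have hr0 : 0 < r := by omega
  have hD : H.Dense := fun w hw i => by
    have := minCodegree_le_card_nbr (H := H) hw i
    rw [Fintype.card_fin]
    omega
  obtain ⟨e, he⟩ := exists_isOrdEdge (H := H) hr0 (by simpa using hn) (by omega)
  obtain ⟨h1, h2⟩ := hD.hasClass_of_odd (fun e he => stab_ne_top hr0 hH he) (by simpa using hn') he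
    hr0
  refine ⟨h1, fun i hi hi1 hir => available_youngSubgroup h1 hi1 (by omega) ?_⟩
  obtain ⟨e', he', h3⟩ := (h2 i hi (by omega)).exists_youngSubgroup_le hD
  exact fun σ hσ => conjAvoiding_stab hr0 hH he' σ (h3 hσ)

end RGraph

/-! ### Extremal numbers and the parity construction -/

namespace RGraph

variable {r : ℕ} {V : Type*}

theorem card_le_degree [Finite V] [DecidableEq V] {H : RGraph r V} {S N : Finset V}
    (h : ∀ x ∈ N, x ∉ S ∧ insert x S ∈ H.edges) : N.card ≤ H.degree S := by
  unfold degree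
  rw [← Set.ncard_coe_finset]
  refine Set.ncard_le_ncard_of_injOn (fun x => insert x S)
    (fun x hx => ⟨(h x hx).2, Finset.subset_insert x S⟩) (fun x hx y hy hxy => ?_) (Set.toFinite _)
  have h1 : x ∈ insert y S := by
    rw [← show insert x S = insert y S from hxy]
    exact Finset.mem_insert_self x S
  exact (Finset.mem_insert.1 h1).resolve_right (h x hx).1

theorem le_minCodegree [Fintype V] {H : RGraph r V} {d : ℕ} (hr : r ≤ Fintype.card V)
    (h : ∀ S : Finset V, S.card = r - 1 → d ≤ H.degree S) : d ≤ H.minCodegree := by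
  obtain ⟨S, -, hS⟩ := Finset.exists_subset_card_eq (s := (Finset.univ : Finset V)) (n := r - 1)
    (by rw [Finset.card_univ]; omega)
  refine le_csInf ⟨_, S, hS, rfl⟩ ?_
  rintro _ ⟨S, hS, rfl⟩
  exact h S hS

theorem minCodegree_le_two_pow [Fintype V] (H : RGraph r V) :
    H.minCodegree ≤ 2 ^ Fintype.card V := by
  rcases Set.eq_empty_or_nonempty {d | ∃ S : Finset V, S.card = r - 1 ∧ d = H.degree S} with h | h
  · unfold minCodegree
    rw [h, Nat.sInf_empty]
    exact Nat.zero_le _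
  · obtain ⟨S, -, hS⟩ := Nat.sInf_mem h
    unfold minCodegree
    rw [hS]
    refine (Set.ncard_le_card _).trans ?_
    simp

theorem _root_.RFamily.bddAbove_minCodegree (F : RFamily r) (n : ℕ) :
    BddAbove {d | ∃ H : RGraph r (Fin n), F.Free H ∧ d = H.minCodegree} := by
  refine ⟨2 ^ n, ?_⟩
  rintro _ ⟨H, -, rfl⟩
  simpa using H.minCodegree_le_two_pow

theorem _root_.RFamily.Free.minCodegree_le {F : RFamily r} {n : ℕ} {H : RGraph r (Fin n)}
    (hH : F.Free H) : H.minCodegree ≤ F.exCodegree n :=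
  le_csSup (F.bddAbove_minCodegree n) ⟨H, hH, rfl⟩

theorem _root_.RFamily.exists_minCodegree_eq {r : ℕ} (k : ℤ) (n : ℕ) :
    ∃ H : RGraph r (Fin n), (RFamily.tightCycles r k).hom.Free H ∧
      H.minCodegree = (RFamily.tightCycles r k).hom.exCodegree n := by
  have h : ((RFamily.tightCycles r k).hom).Free (⟨∅, by simp [Set.Sized]⟩ : RGraph r (Fin n)) := by
    rw [RFamily.free_hom_iff]
    rintro _ ⟨ℓ, hℓ, -, rfl⟩ f hf
    exact hf _ ⟨⟨0, by omega⟩, rfl⟩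
  obtain ⟨H, hH, h1⟩ := Nat.sSup_mem
    (show {d | ∃ H : RGraph r (Fin n), (RFamily.tightCycles r k).hom.Free H ∧
      d = H.minCodegree}.Nonempty from ⟨_, _, h, rfl⟩)
    ((RFamily.tightCycles r k).hom.bddAbove_minCodegree n)
  exact ⟨H, hH, h1.symm⟩

/-- The `r`-graph of all `r`-sets with an odd number of vertices that satisfy `p`. -/
def oddGraph (r : ℕ) (p : V → Prop) [DecidablePred p] : RGraph r V where
  edges := {e | e.card = r ∧ Odd (e.filter p).card}
  sized := fun _ he => he.1

/-- Along a homomorphic cycle, the pattern of membership in `p` has period `r` as well as period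
`ℓ`. Hence `cyc^ℓ = cyc^k` preserves the odd set of marked places in a window, so it has a conjugate
in some `S_m × S_{r-m}` with `m` odd. -/
theorem free_oddGraph {n : ℕ} {k : ℤ} (p : Fin n → Prop) [DecidablePred p] (hr : Even r)
    (h : ∀ i : ℕ, Odd i → 1 ≤ i → i ≤ r - 1 →
      ConjAvoiding (finRotate r ^ k) (youngSubgroup r i)) :
    (RFamily.tightCycles r k).hom.Free (oddGraph r p) := by
  rw [RFamily.free_hom_iff]
  rintro _ ⟨ℓ, hℓ, hℓk, rfl⟩ f hf
  simp only at f hf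
  have hℓ0 : 0 < ℓ := by omega
  set q : ℕ → Prop := fun t => p (f ⟨t % ℓ, Nat.mod_lt _ hℓ0⟩) with hq
  have hodd : ∀ i, Odd (∑ j ∈ Finset.range r, if q (i + j) then 1 else 0) := by
    intro i
    obtain ⟨h1, h2⟩ := hf _ ⟨⟨i % ℓ, Nat.mod_lt _ hℓ0⟩, rfl⟩
    rw [Finset.image_image] at h1 h2
    have hinj := Finset.card_image_iff.1 (h1.trans (Finset.card_fin r).symm)
    rw [Finset.filter_image, Finset.card_image_of_injOn
      (hinj.mono (by simp)), Finset.card_filter] at h2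
    convert h2 using 1
    rw [← Fin.sum_univ_eq_sum_range (fun j => if q (i + j) then 1 else 0)]
    refine Finset.sum_congr rfl fun j _ => ?_
    simp [hq]
  -- The windows at `i` and `i + 1` both have odd sums and differ only in the terms `i` and `i + r`.
  have hper : ∀ i, q (i + r) ↔ q i := by
    intro i
    have h1 := hodd i
    have h2 := hodd (i + 1)
    have h3 := Finset.sum_range_succ (fun j => if q (i + j) then 1 else 0) r
    rw [Finset.sum_range_succ'] at h3
    simp only [add_assoc, add_comm 1] at h2
    simp only [add_zero] at h3
    rw [Nat.odd_iff] at h1 h2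
    split_ifs at h3 <;> first | tauto | omega
  have hmod : ∀ t, q (t % r) ↔ q t := by
    intro t
    have : ∀ s, q (t % r + r * s) ↔ q (t % r) := by
      intro s
      induction s with
      | zero => rfl
      | succ s ih => rw [mul_add, mul_one, ← add_assoc, hper, ih]
    rw [← this (t / r), Nat.mod_add_div]
  have hshift : ∀ t, q (ℓ + t) ↔ q t := fun t => by simp [hq]
  set m := {x : Fin r | q x}.ncard with hm
  have hmodd : Odd m := by
    rw [hm, Set.ncard_eq_toFinset_card', Set.toFinset_ofPred, Finset.card_filter]
    have := hodd 0
    simp only [zero_add] at this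
    rwa [← Fin.sum_univ_eq_sum_range (fun j => if q j then 1 else 0)] at this
  have hmr : m ≤ r := by
    rw [hm]
    simpa using Set.ncard_le_card {x : Fin r | q x}
  have hmne : m ≠ r := by
    rintro h
    rw [h] at hmodd
    exact Nat.not_even_iff_odd.2 hmodd hr
  have h1 : {x : Fin r | x.val < m}.ncard = m := by
    rw [Set.ncard_eq_toFinset_card', Set.toFinset_ofPred, Fin.card_filter_val_lt, min_eq_right hmr]
  obtain ⟨σ, hσ⟩ := Equiv.Perm.exists_apply_iff
    (p := fun x : Fin r => q x) (q := fun x : Fin r => x.val < m) (h1.symm ▸ hm.symm)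
  refine h m hmodd hmodd.pos (by omega) σ (mem_youngSubgroup.2 fun y => ?_)
  obtain ⟨x, rfl⟩ := σ.surjective y
  have h2 : finRotate r ^ k = finRotate r ^ ℓ := by
    have hr0 := x.pos
    rw [finRotate_zpow_eq_pow hr0 k, ← zpow_natCast (finRotate r) ℓ,
      finRotate_zpow_eq_pow hr0 (ℓ : ℤ), show ((ℓ : ℤ) % r) = k % r from hℓk]
  rw [hσ, Equiv.Perm.mul_apply, Equiv.Perm.mul_apply,
    show σ⁻¹ (σ x) = x from σ.symm_apply_apply x, hσ, h2, finRotate_pow_val, hmod, hshift]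

/-- An `(r-1)`-set extends by any new vertex of the half that makes the parity odd. -/
theorem le_minCodegree_oddGraph {n : ℕ} (hr : 0 < r) (hn : r ≤ n) :
    n / 2 - r ≤ (oddGraph r fun v : Fin n => v.val < n / 2).minCodegree := by
  refine le_minCodegree (by simpa using hn) fun S hS => ?_
  have hP : (Finset.univ.filter fun v : Fin n => v.val < n / 2).card = n / 2 := by
    rw [Fin.card_filter_val_lt]
    omega
  have hQ := Finset.card_filter_add_card_filter_not (s := Finset.univ)
    (fun v : Fin n => v.val < n / 2)
  rw [hP, Finset.card_fin] at hQ
  rcases Nat.even_or_odd (S.filter fun v : Fin n => v.val < n / 2).card with h | h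
  · refine le_trans ?_ (card_le_degree (N := (Finset.univ.filter fun v : Fin n => v.val < n / 2) \ S)
      fun x hx => ?_)
    · have := Finset.le_card_sdiff S (Finset.univ.filter fun v : Fin n => v.val < n / 2)
      omega
    · simp only [Finset.mem_sdiff, Finset.mem_filter, Finset.mem_univ, true_and] at hx
      refine ⟨hx.2, ?_, ?_⟩
      · rw [Finset.card_insert_of_notMem hx.2]; omega
      · rw [Finset.filter_insert, if_pos hx.1, Finset.card_insert_of_notMem (by simp [hx.2])]
        exact h.add_one
  · refine le_trans ?_ (card_le_degree
      (N := (Finset.univ.filter fun v : Fin n => ¬ v.val < n / 2) \ S) fun x hx => ?_)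
    · have := Finset.le_card_sdiff S (Finset.univ.filter fun v : Fin n => ¬ v.val < n / 2)
      omega
    · simp only [Finset.mem_sdiff, Finset.mem_filter, Finset.mem_univ, true_and] at hx
      refine ⟨hx.2, ?_, ?_⟩
      · rw [Finset.card_insert_of_notMem hx.2]; omega
      · rw [Finset.filter_insert, if_neg hx.1]
        exact h

end RGraph

/-! ### Random maps and preservation of codegree -/

section Sampling

open Finset

/-- The exponential moment method: weight each map by `q` to the number of hits. Once the values on
`S` are fixed, the target set `N ρ` is fixed and the sum over the remaining values factorizes. -/
theorem card_filter_mul_pow_le {α β : Type*} [Fintype α] [DecidableEq α] [Fintype β]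
    [DecidableEq β] (S : Finset α) (N : (S → β) → Finset β) {D s : ℕ} (hN : ∀ ρ, D ≤ (N ρ).card)
    {q : ℝ} (hq0 : 0 < q) (hq1 : q ≤ 1) :
    ((univ.filter fun φ : α → β =>
        (Sᶜ.filter fun x => φ x ∈ N fun i => φ i).card ≤ s).card : ℝ) * q ^ s
      ≤ (Fintype.card β : ℝ) ^ S.card * (Fintype.card β - D * (1 - q)) ^ (Sᶜ).card := by
  have hsum : ∀ ρ, ∑ v, (if v ∈ N ρ then q else 1) ≤ Fintype.card β - D * (1 - q) := by
    intro ρ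
    have h1 : ∑ v, (if v ∈ N ρ then q else 1) = ∑ v : β, ((1 : ℝ) - if v ∈ N ρ then 1 - q else 0) :=
      sum_congr rfl fun v _ => by split_ifs <;> ring
    rw [h1, sum_sub_distrib, ← sum_filter, sum_const, sum_const]
    have h2 : (D : ℝ) ≤ (N ρ).card := by exact_mod_cast hN ρ
    simp only [card_univ, nsmul_eq_mul, mul_one, filter_univ_mem]
    nlinarith
  have hpos : ∀ ρ, 0 ≤ ∑ v, (if v ∈ N ρ then q else 1) := fun ρ =>
    sum_nonneg fun v _ => by split_ifs <;> positivity
  have hmain : ∑ φ : α → β, q ^ (Sᶜ.filter fun x => φ x ∈ N fun i => φ i).card =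
      ∑ ρ : S → β, (∑ v, (if v ∈ N ρ then q else 1)) ^ (Sᶜ).card := by
    rw [← (Equiv.piEquivPiSubtypeProd (· ∈ S) fun _ => β).symm.sum_comp, Fintype.sum_prod_type]
    refine sum_congr rfl fun ρ _ => ?_
    have h1 : (Sᶜ).card = Fintype.card {x // x ∉ S} := by
      rw [Fintype.card_subtype]
      congr 1
      ext; simp
    rw [h1, ← card_univ, ← prod_const, prod_univ_sum, Fintype.piFinset_univ]
    refine sum_congr rfl fun τ _ => ?_
    rw [card_filter, ← prod_pow_eq_pow_sum, prod_subtype (p := fun x => x ∉ S) _ (by simp)]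
    refine prod_congr rfl fun x _ => ?_
    have h2 : (fun i : S => (Equiv.piEquivPiSubtypeProd (· ∈ S) fun _ => β).symm (ρ, τ) i) = ρ := by
      funext i
      simp [Equiv.piEquivPiSubtypeProd]
    rw [h2]
    simp only [Equiv.piEquivPiSubtypeProd, Equiv.coe_fn_symm_mk, x.2, dite_false]
    split_ifs <;> simp
  calc _ = ∑ φ ∈ univ.filter fun φ : α → β =>
        (Sᶜ.filter fun x => φ x ∈ N fun i => φ i).card ≤ s, q ^ s := by
        rw [sum_const, nsmul_eq_mul]
    _ ≤ ∑ φ ∈ univ.filter fun φ : α → β =>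
        (Sᶜ.filter fun x => φ x ∈ N fun i => φ i).card ≤ s,
        q ^ (Sᶜ.filter fun x => φ x ∈ N fun i => φ i).card :=
        sum_le_sum fun φ hφ => pow_le_pow_of_le_one hq0.le hq1 (mem_filter.1 hφ).2
    _ ≤ ∑ φ : α → β, q ^ (Sᶜ.filter fun x => φ x ∈ N fun i => φ i).card :=
        sum_le_sum_of_subset_of_nonneg (filter_subset _ _) fun _ _ _ => by positivity
    _ ≤ ∑ ρ : S → β, (Fintype.card β - D * (1 - q)) ^ (Sᶜ).card := by
        rw [hmain]
        exact sum_le_sum fun ρ _ => pow_le_pow_left₀ (hpos ρ) (hsum ρ) _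
    _ = _ := by
        rw [sum_const, nsmul_eq_mul, card_univ, Fintype.card_fun, Fintype.card_coe]
        push_cast
        rfl

theorem card_filter_le_exp {α β : Type*} [Fintype α] [DecidableEq α] [Fintype β]
    [DecidableEq β] (S : Finset α) (N : (S → β) → Finset β) {D s : ℕ} (hN : ∀ ρ, D ≤ (N ρ).card)
    (hD : D ≤ Fintype.card β) (hβ : 0 < Fintype.card β) {ε : ℝ} (hε : 0 < ε) (hε1 : ε ≤ 1)
    (hs : (s : ℝ) ≤ (D / Fintype.card β - ε) * (Sᶜ).card) :
    ((univ.filter fun φ : α → β => (Sᶜ.filter fun x => φ x ∈ N fun i => φ i).card ≤ s).card : ℝ)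
      ≤ (Fintype.card β : ℝ) ^ Fintype.card α * Real.exp (-(ε ^ 2 / 4) * (Sᶜ).card) := by
  -- The choice `q = exp (-ε/2)` yields the exponent `ε²/4`, via `exp (-x) ≤ 1 - x + x²`.
  have h := card_filter_mul_pow_le S N (s := s) hN (Real.exp_pos (-(ε / 2)))
    (Real.exp_le_one_iff.2 (by linarith))
  set n : ℝ := (Fintype.card β : ℝ) with hn
  have hn0 : 0 < n := by rw [hn]; exact_mod_cast hβ
  set δ : ℝ := D / n with hδ
  have hδ0 : 0 ≤ δ := by positivity
  have hδ1 : δ ≤ 1 := by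
    rw [hδ, div_le_one hn0, hn]
    exact_mod_cast hD
  set M := (Sᶜ).card with hM
  have hexp : Real.exp (-(ε / 2)) ≤ 1 - ε / 2 + (ε / 2) ^ 2 := by
    have := abs_le.1 (Real.abs_exp_sub_one_sub_id_le (x := -(ε / 2))
      (by rw [abs_neg, abs_of_pos (by positivity)]; linarith))
    nlinarith [this.2]
  have h1 : n - D * (1 - Real.exp (-(ε / 2))) = n * (1 - δ * (1 - Real.exp (-(ε / 2)))) := by
    rw [hδ]
    field_simp
  have h2 : 1 - δ * (1 - Real.exp (-(ε / 2))) ≤ Real.exp (-(δ * (ε / 2 - (ε / 2) ^ 2))) := by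
    refine le_trans ?_ (Real.one_sub_le_exp_neg _)
    nlinarith
  have h3 : 0 ≤ 1 - δ * (1 - Real.exp (-(ε / 2))) := by
    have := Real.exp_pos (-(ε / 2))
    nlinarith
  have h4 : S.card + M = Fintype.card α := card_add_card_compl S
  rw [← le_div_iff₀ (by positivity)] at h
  refine h.trans ?_
  rw [div_le_iff₀ (by positivity), h1, mul_pow, ← mul_assoc, ← pow_add, h4, mul_assoc]
  refine mul_le_mul_of_nonneg_left ?_ (by positivity)
  refine (pow_le_pow_left₀ h3 h2 M).trans ?_
  rw [← Real.exp_nat_mul, ← Real.exp_nat_mul, ← Real.exp_add, Real.exp_le_exp]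
  have hM0 : (0 : ℝ) ≤ M := Nat.cast_nonneg _
  nlinarith [mul_le_mul_of_nonneg_left hs (by positivity : 0 ≤ ε / 2),
    mul_nonneg (mul_nonneg hM0 (sq_nonneg ε)) (sub_nonneg.2 hδ1)]

end Sampling

namespace RGraph

open Finset

variable {r : ℕ}

/-- A union bound over the `(r-1)`-sets: by `hmn` the maps that are bad for some set are fewer than
the injective maps, of which there are at least `(n + 1 - m)^m`. -/
theorem exists_le_minCodegree_comap {m n : ℕ} (H : RGraph r (Fin n)) (hr : 0 < r) (hrm : r ≤ m)
    (hrn : r ≤ n) {ε : ℝ} (hε : 0 < ε) (hε1 : ε ≤ 1)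
    (hmn : (m : ℝ) ^ (r - 1) * Real.exp (-(ε ^ 2 / 4) * (m - (r - 1) : ℕ)) * (n : ℝ) ^ m
      < ((n + 1 - m : ℕ) : ℝ) ^ m) :
    ∃ φ : Fin m → Fin n,
      ((H.minCodegree : ℝ) / n - ε) * m - r ≤ ((H.comap φ).minCodegree : ℝ) := by
  classical
  have hn0 : 0 < n := by omega
  obtain ⟨S₀, -, hS₀⟩ := exists_subset_card_eq (s := (univ : Finset (Fin n))) (n := r - 1)
    (by rw [card_fin]; omega)
  have hdeg : ∀ S : Finset (Fin n), S.card = r - 1 →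
      H.minCodegree ≤ (univ.filter fun v => insert v S ∈ H.edges).card := fun S hS =>
    le_trans (Nat.sInf_le ⟨S, hS, rfl⟩)
      (degree_le_card_of_forall_mem hr hS fun x hx => by simpa using hx)
  have hDn : H.minCodegree ≤ Fintype.card (Fin n) := (hdeg S₀ hS₀).trans (card_le_univ _)
  rcases lt_or_ge ((H.minCodegree : ℝ) / n - ε) 0 with hneg | hnonneg
  · refine ⟨fun _ => ⟨0, hn0⟩, ?_⟩
    have h1 : ((H.minCodegree : ℝ) / n - ε) * m ≤ 0 :=
      mul_nonpos_of_nonpos_of_nonneg hneg.le (Nat.cast_nonneg _)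
    have h2 : (0 : ℝ) ≤ r := Nat.cast_nonneg _
    have h3 : (0 : ℝ) ≤ ((H.comap fun _ : Fin m => (⟨0, hn0⟩ : Fin n)).minCodegree : ℝ) :=
      Nat.cast_nonneg _
    linarith
  set δ : ℝ := (H.minCodegree : ℝ) / n - ε with hδ
  have hδ1 : δ ≤ 1 := by
    have : (H.minCodegree : ℝ) / n ≤ 1 := by
      rw [div_le_one (by exact_mod_cast hn0)]
      rw [Fintype.card_fin] at hDn
      exact_mod_cast hDn
    linarith
  set s := ⌊δ * (m - (r - 1) : ℕ)⌋₊ with hs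
  have hs1 : (s : ℝ) ≤ δ * (m - (r - 1) : ℕ) := Nat.floor_le (by positivity)
  have hs2 : δ * (m - (r - 1) : ℕ) < s + 1 := Nat.lt_floor_add_one _
  -- Where `ρ` is not injective the whole vertex set is a dummy value, so that the lower bound on
  -- the size of `N S ρ` holds for all `ρ`.
  set N : (S : Finset (Fin m)) → (S → Fin n) → Finset (Fin n) := fun S ρ =>
    if (univ.image ρ).card = r - 1 then univ.filter fun v => insert v (univ.image ρ) ∈ H.edges
    else univ with hN
  have hNcard : ∀ S ρ, H.minCodegree ≤ (N S ρ).card := by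
    intro S ρ
    simp only [hN]
    split_ifs with h
    · exact hdeg _ h
    · rwa [card_univ]
  set bad : Finset (Fin m) → Finset (Fin m → Fin n) := fun S => univ.filter fun φ =>
    (Sᶜ.filter fun x => φ x ∈ N S fun i => φ i).card ≤ s with hbad
  have hbadcard : ∀ S ∈ powersetCard (r - 1) (univ : Finset (Fin m)), ((bad S).card : ℝ) ≤
      (n : ℝ) ^ m * Real.exp (-(ε ^ 2 / 4) * (m - (r - 1) : ℕ)) := by
    intro S hS
    have hSc : (Sᶜ).card = m - (r - 1) := by
      rw [card_compl, Fintype.card_fin, (mem_powersetCard.1 hS).2]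
    have := card_filter_le_exp S (N S) (s := s) (hNcard S) hDn (by simpa using hn0) hε hε1
      (by rw [hSc, Fintype.card_fin]; exact hs1)
    rwa [hSc, Fintype.card_fin, Fintype.card_fin] at this
  obtain ⟨φ, hφ, hφbad⟩ : ∃ φ : Fin m → Fin n, Function.Injective φ ∧
      ∀ S : Finset (Fin m), S.card = r - 1 → φ ∉ bad S := by
    by_contra! hcon
    have hsub : (univ.filter fun φ : Fin m → Fin n => Function.Injective φ) ⊆
        (powersetCard (r - 1) univ).biUnion bad := by
      intro φ hφ
      obtain ⟨S, hS, hb⟩ := hcon φ (mem_filter.1 hφ).2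
      exact mem_biUnion.2 ⟨S, mem_powersetCard.2 ⟨subset_univ _, hS⟩, hb⟩
    have hinj : (univ.filter fun φ : Fin m → Fin n => Function.Injective φ).card
        = n.descFactorial m := by
      rw [← Fintype.card_subtype, Fintype.card_congr (Equiv.subtypeInjectiveEquivEmbedding _ _),
        Fintype.card_embedding_eq, Fintype.card_fin, Fintype.card_fin]
    have h1 : ((n + 1 - m : ℕ) : ℝ) ^ m ≤ ((powersetCard (r - 1) univ).biUnion bad).card := by
      exact_mod_cast (Nat.pow_sub_le_descFactorial n m).trans (hinj ▸ card_le_card hsub)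
    have h2 : (((powersetCard (r - 1) univ).biUnion bad).card : ℝ) ≤
        ∑ S ∈ powersetCard (r - 1) univ, ((bad S).card : ℝ) := by
      exact_mod_cast card_biUnion_le
    have h3 := sum_le_sum hbadcard
    rw [sum_const, card_powersetCard, card_fin, nsmul_eq_mul] at h3
    have h4 : ((m.choose (r - 1) : ℕ) : ℝ) ≤ (m : ℝ) ^ (r - 1) := by
      exact_mod_cast Nat.choose_le_pow m (r - 1)
    have h5 := mul_le_mul_of_nonneg_right h4 (by positivity : 0 ≤
      (n : ℝ) ^ m * Real.exp (-(ε ^ 2 / 4) * (m - (r - 1) : ℕ)))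
    linarith
  refine ⟨φ, ?_⟩
  have hmin : s + 1 ≤ (H.comap φ).minCodegree := by
    refine le_minCodegree (by simpa using hrm) fun S hS => ?_
    have h1 := hφbad S hS
    simp only [hbad, mem_filter, mem_univ, true_and, not_le] at h1
    refine le_trans h1 (card_le_degree fun x hx => ?_)
    obtain ⟨hxS, hx⟩ := mem_filter.1 hx
    rw [mem_compl] at hxS
    have himg : (univ.image fun i : S => φ i) = S.image φ := by
      ext v
      simp
    have hx' : insert (φ x) (S.image φ) ∈ H.edges := by
      simp only [hN, himg] at hx
      rw [if_pos (by rw [card_image_of_injective _ hφ, hS])] at hx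
      exact (mem_filter.1 hx).2
    refine ⟨hxS, ?_, ?_⟩
    · rw [card_insert_of_notMem hxS]; omega
    · rwa [image_insert]
  have hmin' : ((s + 1 : ℕ) : ℝ) ≤ (H.comap φ).minCodegree := by exact_mod_cast hmin
  have hcast : ((m - (r - 1) : ℕ) : ℝ) = m - (r - 1) := by
    rw [Nat.cast_sub (by omega), Nat.cast_sub (by omega), Nat.cast_one]
  have hr1 : (1 : ℝ) ≤ r := by exact_mod_cast hr
  rw [hcast] at hs2
  push_cast at hmin'
  nlinarith

end RGraph

/-! ### Existence of the limit and conclusion -/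

/-- Letting `n` grow gives `limsup a ≤ a m + ε` for all large `m`, so `a` eventually stays above
every number below its limsup. -/
theorem exists_tendsto_of_le_add {a : ℕ → ℝ} (h0 : ∀ᶠ n in atTop, 0 ≤ a n)
    (h1 : ∀ᶠ n in atTop, a n ≤ 1)
    (h : ∀ ε > 0, ∀ᶠ m in atTop, ∀ᶠ n in atTop, a n ≤ a m + ε) :
    ∃ γ, Tendsto a atTop (𝓝 γ) := by
  have hbdd : IsBoundedUnder (· ≤ ·) atTop a := ⟨1, by simpa using h1⟩
  have hcob : IsCoboundedUnder (· ≤ ·) atTop a :=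
    IsBoundedUnder.isCoboundedUnder_le ⟨0, by simpa using h0⟩
  refine ⟨limsup a atTop, tendsto_order.2 ⟨fun c hc => ?_, fun c hc =>
    eventually_lt_of_limsup_lt hc hbdd⟩⟩
  filter_upwards [h ((limsup a atTop - c) / 2) (by linarith)] with m hm
  have := limsup_le_of_le hcob hm
  linarith

theorem RFamily.exists_hasCodegreeDensity {r : ℕ} (hr : 2 ≤ r) (k : ℤ) :
    ∃ γ, (RFamily.tightCycles r k).hom.HasCodegreeDensity γ := by
  have hr0 : 0 < r := by omega
  refine exists_tendsto_of_le_add (Eventually.of_forall fun n => by positivity) ?_ ?_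
  · filter_upwards [eventually_ge_atTop r] with n hn
    obtain ⟨H, hH, h⟩ := RFamily.exists_minCodegree_eq (r := r) k n
    have h1 := RGraph.two_mul_minCodegree_le hr0 hn hH
    rw [div_le_one (by exact_mod_cast (by omega : 0 < n)), ← h]
    exact_mod_cast (by omega : H.minCodegree ≤ n)
  intro ε' hε'
  -- Half of `ε'` pays for the deviation in sampling, the other half for the additive loss `r`,
  -- which is at most `ε * m` for large `m`.
  set ε : ℝ := min (ε' / 2) 1 with hεdef
  have hε : 0 < ε := by positivity
  have hε1 : ε ≤ 1 := min_le_right _ _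
  have hε2 : ε ≤ ε' / 2 := min_le_left _ _
  have hlim1 : ∀ᶠ m : ℕ in atTop,
      (m : ℝ) ^ (r - 1) * Real.exp (-(ε ^ 2 / 4) * (m - (r - 1) : ℕ)) < 1 / 2 := by
    have h1 := ((tendsto_rpow_mul_exp_neg_mul_atTop_nhds_zero (r - 1 : ℕ) (ε ^ 2 / 4)
      (by positivity)).comp tendsto_natCast_atTop_atTop).mul_const
        (Real.exp (ε ^ 2 / 4 * (r - 1 : ℕ)))
    rw [zero_mul] at h1
    filter_upwards [h1.eventually_lt_const (by norm_num : (0 : ℝ) < 1 / 2),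
      eventually_ge_atTop r] with m hm hrm
    rw [Function.comp, Real.rpow_natCast, mul_assoc, ← Real.exp_add] at hm
    rw [Nat.cast_sub (by omega : r - 1 ≤ m), show -(ε ^ 2 / 4) * ((m : ℝ) - (r - 1 : ℕ)) =
      -(ε ^ 2 / 4) * m + ε ^ 2 / 4 * (r - 1 : ℕ) by ring]
    exact hm
  -- Bernoulli's inequality: `(1 - m/n)^m ≥ 1 - m²/n ≥ 1/2`, so at least half of all maps are
  -- injective.
  have hlim2 : ∀ m : ℕ, ∀ᶠ n : ℕ in atTop, 1 / 2 * (n : ℝ) ^ m ≤ ((n + 1 - m : ℕ) : ℝ) ^ m := by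
    intro m
    filter_upwards [eventually_ge_atTop (2 * m ^ 2 + m + 1)] with n hn
    have hn0 : (0 : ℝ) < n := by exact_mod_cast (by omega : 0 < n)
    have hmn : (m : ℝ) / n ≤ 1 := by
      rw [div_le_one hn0]
      exact_mod_cast (by omega : m ≤ n)
    have h1 : (n : ℝ) * (1 + -(m / n)) ≤ ((n + 1 - m : ℕ) : ℝ) := by
      rw [Nat.cast_sub (by omega)]
      push_cast
      have : (n : ℝ) * (1 + -(m / n)) = n - m := by field_simp; ring
      linarith
    have h2 := one_add_mul_le_pow (a := -((m : ℝ) / n)) (by linarith) m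
    have h3 : (m : ℝ) * (m / n) ≤ 1 / 2 := by
      rw [← mul_div_assoc, div_le_iff₀ hn0]
      have : (2 * m ^ 2 : ℝ) ≤ n := by exact_mod_cast (by omega : 2 * m ^ 2 ≤ n)
      nlinarith
    calc 1 / 2 * (n : ℝ) ^ m ≤ (1 + -((m : ℝ) / n)) ^ m * n ^ m :=
          mul_le_mul_of_nonneg_right (by linarith) (by positivity)
      _ = (n * (1 + -((m : ℝ) / n))) ^ m := by rw [mul_pow, mul_comm]
      _ ≤ _ := pow_le_pow_left₀ (mul_nonneg hn0.le (by linarith)) h1 m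
  filter_upwards [hlim1, eventually_ge_atTop r, eventually_ge_atTop ⌈r / ε⌉₊] with m hm hrm hmε
  filter_upwards [hlim2 m, eventually_ge_atTop r] with n hn hrn
  obtain ⟨H, hH, hHex⟩ := RFamily.exists_minCodegree_eq (r := r) k n
  have hn0 : (0 : ℝ) < n := by exact_mod_cast (by omega : 0 < n)
  have hm0 : (0 : ℝ) < m := by exact_mod_cast (by omega : 0 < m)
  obtain ⟨φ, hφ⟩ := H.exists_le_minCodegree_comap hr0 hrm hrn hε hε1
    ((mul_lt_mul_of_pos_right hm (by positivity)).trans_le hn)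
  have h1 : ((H.comap φ).minCodegree : ℝ) ≤ (RFamily.tightCycles r k).hom.exCodegree m := by
    exact_mod_cast (RGraph.free_comap hH φ).minCodegree_le
  have h2 : (r : ℝ) ≤ ε * m := by
    have := Nat.ceil_le.1 hmε
    rwa [div_le_iff₀ hε, mul_comm] at this
  rw [← hHex, ← sub_le_iff_le_add, le_div_iff₀ hm0]
  nlinarith

theorem theorem4p3 (r : ℕ) (hr : 2 ≤ r) (k : ℤ) (hk : ¬ k ≡ 0 [ZMOD r]) :
    ∃ γ : ℝ, (RFamily.tightCycles r k).hom.HasCodegreeDensity γ ∧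
      ((Even r ∧ ∀ i : ℕ, Odd i → 1 ≤ i → i ≤ r - 1 → Available r k (youngSubgroup r i)) →
        γ = 1 / 2) ∧
      (¬ (Even r ∧ ∀ i : ℕ, Odd i → 1 ≤ i → i ≤ r - 1 → Available r k (youngSubgroup r i)) →
        γ ≤ 1 / 3) := by
  have hr0 : 0 < r := by omega
  obtain ⟨γ, hγ⟩ := RFamily.exists_hasCodegreeDensity hr k
  refine ⟨γ, hγ, fun ⟨heven, hav⟩ => le_antisymm ?_ ?_, fun hnot => ?_⟩
  · refine le_of_tendsto hγ ?_
    filter_upwards [eventually_ge_atTop r] with n hn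
    obtain ⟨H, hH, h⟩ := RFamily.exists_minCodegree_eq (r := r) k n
    have h1 : (2 * H.minCodegree : ℝ) ≤ n := by
      exact_mod_cast RGraph.two_mul_minCodegree_le hr0 hn hH
    rw [div_le_iff₀ (by exact_mod_cast (by omega : 0 < n)), ← h]
    linarith
  · have hlim : Tendsto (fun n : ℕ => 1 / 2 - ((r : ℝ) + 1) * (1 / (n : ℝ))) atTop (𝓝 (1 / 2)) := by
      simpa using (tendsto_one_div_atTop_nhds_zero_nat.const_mul ((r : ℝ) + 1)).const_sub
        (1 / 2 : ℝ)
    refine le_of_tendsto_of_tendsto hlim hγ ?_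
    filter_upwards [eventually_ge_atTop r] with n hn
    have h1 := (RGraph.le_minCodegree_oddGraph hr0 hn).trans
      (RGraph.free_oddGraph (k := k) (fun v : Fin n => v.val < n / 2) heven
        fun i h1 h2 h3 => (hav i h1 h2 h3).1).minCodegree_le
    have h2 : (n : ℝ) ≤ 2 * ((RFamily.tightCycles r k).hom.exCodegree n + r + 1) := by
      exact_mod_cast (by omega)
    have hn0 : (0 : ℝ) < n := by exact_mod_cast (by omega : 0 < n)
    rw [le_div_iff₀ hn0, sub_mul, mul_assoc, one_div_mul_cancel hn0.ne']
    linarith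
  · refine le_of_tendsto hγ ?_
    filter_upwards [eventually_ge_atTop r, eventually_ge_atTop 3] with n hn hn'
    obtain ⟨H, hH, h⟩ := RFamily.exists_minCodegree_eq (r := r) k n
    have h1 : (3 * H.minCodegree : ℝ) ≤ n := by
      by_contra! h2
      exact hnot (RGraph.available_of_lt_three_mul_minCodegree hr hn hn' hH (by exact_mod_cast h2))
    rw [div_le_iff₀ (by exact_mod_cast (by omega : 0 < n)), ← h]
    linarith
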